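/- Let $\mathcal S^{n}$ be the space of real symmetric $n\times n$ matrices with the Frobenius norm $\|\cdot\|_F$, $\mathcal O(n)$ the orthogonal group, and $\mathbb R^n_{\ge}=\{x\in\mathbb R^n : x_1\ge x_2\ge\cdots\ge x_n\}$ with the Euclidean norm $\|\cdot\|$. For $X\in\mathcal S^n$ let $\lambda(X)\in\mathbb R^n_{\ge}$ be the vector of eigenvalues of $X$, with multiplicity, in descending order. Let $F:\mathcal S^n\to\mathbb R$ and $G:\mathcal S^n\to\mathbb R^p$ be functions, let $C\subseteq\mathbb R^n$ be a set (for instance a closed set), and put $$\mathcal X_1=\{X\in\mathcal S^n : G(X)=0,\ \lambda(X)\in C\},$$ $$\mathcal X_2=\{(Q,\lambda)\in\mathcal O(n)\times\mathbb R^n_{\ge} : G(Q\operatorname{Diag}(\lambda)Q^\top)=0,\ \lambda\in C\},$$ $$f(Q,\lambda)=F(Q\operatorname{Diag}(\lambda)Q^\top).$$ Call $X^*\in\mathcal S^n$ a local minimum of the symmetric problem $\min_{\mathcal X_1}F$ if there is $\delta>0$ such that $F(X^*)\le F(X)$ for all $X\in\mathcal X_1$ with $\|X-X^*\|_F\le\delta$.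 Call $(Q^*,\lambda^*)\in\mathcal O(n)\times\mathbb R^n_{\ge}$ a local minimum of the decomposed problem $\min_{\mathcal X_2}f$ if there is $\delta>0$ such that $f(Q^*,\lambda^*)\le f(Q,\lambda)$ for all $(Q,\lambda)\in\mathcal X_2$ with $\|Q-Q^*\|_F\le\delta$ and $\|\lambda-\lambda^*\|\le\delta$. A spectral decomposition of $X$ is a pair $(Q,\lambda)\in\mathcal O(n)\times\mathbb R^n_{\ge}$ with $X=Q\operatorname{Diag}(\lambda)Q^\top$. Theorem. Let $X^*\in\mathcal S^n$ have pairwise distinct eigenvalues. Then $X^*$ is a local minimum of the symmetric problem if and only if one of its spectral decompositions is a local minimum of the decomposed problem. Furthermore, if one spectral decomposition of $X^*$ is a local minimum of the decomposed problem, then all of its spectral decompositions are. Finally, for every spectral decomposition $(Q,\lambda)$ of $X^*$ one has $X^*\in\mathcal X_1$ if and only if $(Q,\lambda)\in\mathcal X_2$, so that the two previous assertions hold equally when local minima are required to be feasible. -/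

import Mathlib

namespace SpecOpt

/-- The space of real symmetric `n × n` matrices. -/
abbrev SymMat (n : ℕ) : Type :=
  {X : Matrix (Fin n) (Fin n) ℝ // X.IsSymm}

/-- The vectors of `ℝⁿ` with entries in decreasing order, `x₁ ≥ x₂ ≥ ⋯ ≥ xₙ`. -/
abbrev OrderedVec (n : ℕ) : Type :=
  {x : EuclideanSpace ℝ (Fin n) // Antitone (fun i => x i)}

/-- The orthogonal group `O(n)`. -/
abbrev Orth (n : ℕ) : Type :=
  Matrix.orthogonalGroup (Fin n) ℝ

theorem SymMat.isHermitian {n : ℕ} (X : SymMat n) : X.1.IsHermitian := by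
  have h : X.1.transpose = X.1 := X.2
  rw [Matrix.IsHermitian, Matrix.conjTranspose_eq_transpose_of_trivial, h]

/-- The vector `λ(X)` of eigenvalues of `X`, with multiplicity, in descending order. -/
noncomputable def eigenvalueVec {n : ℕ} (X : SymMat n) : EuclideanSpace ℝ (Fin n) :=
  WithLp.toLp 2 fun i => X.isHermitian.eigenvalues₀ (Fin.cast (Fintype.card_fin n).symm i)

/-- All eigenvalues of `X` are distinct. -/
def HasDistinctEigenvalues {n : ℕ} (X : SymMat n) : Prop :=
  Function.Injective (fun i => eigenvalueVec X i)

/-- The symmetric matrix `Q Diag(l) Qᵀ`. -/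
def compose {n : ℕ} (Q : Orth n) (l : EuclideanSpace ℝ (Fin n)) : SymMat n :=
  ⟨Q.1 * Matrix.diagonal (fun i => l i) * Q.1.transpose, by
    simp [Matrix.IsSymm, Matrix.transpose_mul, Matrix.mul_assoc]⟩

/-- `(Q, l) ∈ O(n) × ℝⁿ_≥` is a spectral decomposition of `X`. -/
def IsSpectralDecomposition {n : ℕ} (X : SymMat n) (P : Orth n × OrderedVec n) : Prop :=
  X = compose P.1 P.2.1

/-- The Frobenius distance between two real matrices. -/
noncomputable def frobDist {n : ℕ} (A B : Matrix (Fin n) (Fin n) ℝ) : ℝ :=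
  letI := @Matrix.frobeniusNormedAddCommGroup (Fin n) (Fin n) ℝ _ _ _
  ‖A - B‖

/-- The feasible set `{X | G(X) = 0, λ(X) ∈ C}` of the symmetric matrix problem. -/
def feasibleSym {n p : ℕ} (G : SymMat n → EuclideanSpace ℝ (Fin p))
    (C : Set (EuclideanSpace ℝ (Fin n))) : Set (SymMat n) :=
  {X | G X = 0 ∧ eigenvalueVec X ∈ C}

/-- The feasible set `{(Q, l) ∈ O(n) × ℝⁿ_≥ | G(Q Diag(l) Qᵀ) = 0, l ∈ C}` of the decomposed
problem. -/
def feasibleDecomp {n p : ℕ} (G : SymMat n → EuclideanSpace ℝ (Fin p))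
    (C : Set (EuclideanSpace ℝ (Fin n))) : Set (Orth n × OrderedVec n) :=
  {P | G (compose P.1 P.2.1) = 0 ∧ P.2.1 ∈ C}

/-- `X` is a local minimum of `F` over the feasible set of the symmetric matrix problem. -/
def IsLocalMinSym {n p : ℕ} (F : SymMat n → ℝ) (G : SymMat n → EuclideanSpace ℝ (Fin p))
    (C : Set (EuclideanSpace ℝ (Fin n))) (X : SymMat n) : Prop :=
  ∃ δ : ℝ, 0 < δ ∧ ∀ Y ∈ feasibleSym G C, frobDist Y.1 X.1 ≤ δ → F X ≤ F Y

/-- `P = (Q, l)` is a local minimum of `f(Q, l) = F(Q Diag(l) Qᵀ)` over the feasible set of the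
decomposed problem. -/
def IsLocalMinDecomp {n p : ℕ} (F : SymMat n → ℝ) (G : SymMat n → EuclideanSpace ℝ (Fin p))
    (C : Set (EuclideanSpace ℝ (Fin n))) (P : Orth n × OrderedVec n) : Prop :=
  ∃ δ : ℝ, 0 < δ ∧ ∀ R ∈ feasibleDecomp G C,
    frobDist R.1.1 P.1.1 ≤ δ → ‖R.2.1 - P.2.1‖ ≤ δ →
      F (compose P.1 P.2.1) ≤ F (compose R.1 R.2.1)

end SpecOpt

open Filter Topology Matrix

namespace SpecOpt

variable {n : ℕ}

/-! The map `(Q, l) ↦ Q Diag(l) Qᵀ` is continuous and preserves feasibility, since an ordered `l` is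
the eigenvalue vector of its image. Hence a local minimum at `X` passes to every spectral
decomposition of `X`, even with repeated eigenvalues (`IsLocalMinSym.isLocalMinDecomp`).

Conversely (`IsLocalMinDecomp.isLocalMinSym`), suppose feasible points better than `X` converge to
`X`. As `O(n)` is compact, a subsequence of their decompositions converges to a decomposition of
`X`, perhaps not the given `P`. Distinct eigenvalues make the two orthogonal factors differ by a
diagonal orthogonal matrix; dividing by it moves the limit to `P` without changing the points,
contradicting minimality at `P`. -/

theorem frobDist_eq_sqrt (A B : Matrix (Fin n) (Fin n) ℝ) :
    frobDist A B = √(∑ i, ∑ j, (A i j - B i j) ^ 2) := by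
  simp [frobDist, Matrix.frobenius_norm_def, Real.sqrt_eq_rpow]

theorem abs_sub_le_frobDist (A B : Matrix (Fin n) (Fin n) ℝ) (i j : Fin n) :
    |A i j - B i j| ≤ frobDist A B := by
  rw [frobDist_eq_sqrt]
  refine Real.abs_le_sqrt ?_
  refine (Finset.single_le_sum (f := fun j => (A i j - B i j) ^ 2)
    (fun _ _ => sq_nonneg _) (Finset.mem_univ j)).trans ?_
  exact Finset.single_le_sum (f := fun i => ∑ j, (A i j - B i j) ^ 2)
    (fun _ _ => Finset.sum_nonneg fun _ _ => sq_nonneg _) (Finset.mem_univ i)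

theorem tendsto_iff_tendsto_frobDist {ι : Type*} {l : Filter ι}
    {A : ι → Matrix (Fin n) (Fin n) ℝ} {B : Matrix (Fin n) (Fin n) ℝ} :
    Tendsto A l (𝓝 B) ↔ Tendsto (fun k => frobDist (A k) B) l (𝓝 0) := by
  constructor
  · intro h
    have hc : Continuous fun M : Matrix (Fin n) (Fin n) ℝ => frobDist M B := by
      simp only [frobDist_eq_sqrt]
      fun_prop
    have h0 : frobDist B B = 0 := by simp [frobDist_eq_sqrt]
    simpa [h0, Function.comp_def] using (hc.tendsto B).comp h
  · intro h
    refine tendsto_pi_nhds.2 fun i => tendsto_pi_nhds.2 fun j => ?_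
    rw [tendsto_iff_dist_tendsto_zero]
    exact squeeze_zero (fun _ => dist_nonneg) (fun k => abs_sub_le_frobDist (A k) B i j) h

theorem Orth.transpose_mul_self (Q : Orth n) : Q.1ᵀ * Q.1 = 1 :=
  (Matrix.mem_orthogonalGroup_iff' (Fin n) ℝ).1 Q.2

theorem Orth.mul_transpose_self (Q : Orth n) : Q.1 * Q.1ᵀ = 1 :=
  (Matrix.mem_orthogonalGroup_iff (Fin n) ℝ).1 Q.2

theorem isCompact_orthogonalGroup :
    IsCompact (Matrix.orthogonalGroup (Fin n) ℝ : Set (Matrix (Fin n) (Fin n) ℝ)) := by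
  have hK : IsCompact (Set.univ.pi fun _ => Set.univ.pi fun _ => Set.Icc (-1) 1 :
      Set (Fin n → Fin n → ℝ)) :=
    isCompact_univ_pi fun _ => isCompact_univ_pi fun _ => isCompact_Icc
  refine hK.of_isClosed_subset (isClosed_unitary (R := Matrix (Fin n) (Fin n) ℝ)) ?_
  intro U hU i _ j _
  exact abs_le.1 (entry_norm_bound_of_unitary hU i j)

theorem transpose_mul_compose_mul (Q : Orth n) (l : EuclideanSpace ℝ (Fin n)) :
    Q.1ᵀ * (compose Q l).1 * Q.1 = diagonal fun i => l i := by
  simp only [compose, Matrix.mul_assoc, Q.transpose_mul_self, Matrix.mul_one]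
  rw [← Matrix.mul_assoc, Q.transpose_mul_self, Matrix.one_mul]

theorem antitone_eigenvalueVec (X : SymMat n) : Antitone fun i => eigenvalueVec X i :=
  fun _ _ hij => X.isHermitian.eigenvalues₀_antitone (by simpa using hij)

/-- The eigenvalue vector of `Q Diag(l) Qᵀ` is `l`, as soon as `l` is in decreasing order. -/
theorem eigenvalueVec_compose (Q : Orth n) (l : OrderedVec n) :
    eigenvalueVec (compose Q l.1) = l.1 := by
  have hchar : (compose Q l.1).1.charpoly.roots = Multiset.map (fun i => l.1 i) Finset.univ.val := by
    have h : (compose Q l.1).1.charpoly = (diagonal fun i => l.1 i).charpoly := by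
      rw [← transpose_mul_compose_mul Q l.1, Matrix.charpoly_mul_comm, ← Matrix.mul_assoc,
        Q.mul_transpose_self, Matrix.one_mul]
    rw [h, Matrix.charpoly_diagonal, Polynomial.roots_prod]
    · simp
    · simp [Finset.prod_ne_zero_iff, Polynomial.X_sub_C_ne_zero]
  have hroots := (compose Q l.1).isHermitian.roots_charpoly_eq_eigenvalues₀
  -- Characteristic roots determine the entries only as a multiset; monotonicity of both vectors
  -- then fixes the order.
  have hperm : (List.ofFn fun i => eigenvalueVec (compose Q l.1) i).Perm
      (List.ofFn fun i => l.1 i) := by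
    rw [← Multiset.coe_eq_coe, ← Fin.univ_val_map (fun i => l.1 i), ← hchar, hroots,
      Fin.univ_val_map, Multiset.coe_eq_coe,
      List.ofFn_congr (Fintype.card_fin n) (RCLike.ofReal ∘ _)]
    rfl
  have heq := hperm.eq_of_sortedGE
    (antitone_eigenvalueVec _).sortedGE_ofFn
    l.2.sortedGE_ofFn
  ext i
  exact congrFun (List.ofFn_injective heq) i

theorem exists_isSpectralDecomposition (X : SymMat n) : ∃ P, IsSpectralDecomposition X P := by
  -- `eigenvalues` is indexed through an arbitrary bijection; `σ` undoes it, so permuting the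
  -- eigenvector columns puts the eigenvalues in decreasing order.
  let σ : Fin n ≃ Fin n := (Fintype.equivOfCardEq (Fintype.card_fin _)).symm.trans
    (finCongr (Fintype.card_fin n))
  let U := X.isHermitian.eigenvectorUnitary
  have hσ : X.isHermitian.eigenvalues = fun i => eigenvalueVec X (σ i) := by
    ext i
    simp [Matrix.IsHermitian.eigenvalues, eigenvalueVec, σ]
  have hU : U.1 * U.1ᵀ = 1 := Orth.mul_transpose_self U
  let Q : Orth n := ⟨U.1.submatrix id σ.symm, by
    rw [Matrix.mem_orthogonalGroup_iff, transpose_submatrix, submatrix_mul_equiv, hU]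
    simp⟩
  refine ⟨(Q, ⟨eigenvalueVec X, antitone_eigenvalueVec X⟩), Subtype.ext ?_⟩
  have hd : (diagonal fun i => eigenvalueVec X i) =
      (diagonal X.isHermitian.eigenvalues).submatrix σ.symm σ.symm := by
    rw [submatrix_diagonal_equiv, hσ]
    simp [Function.comp_def]
  have hs := X.isHermitian.spectral_theorem
  rw [Unitary.conjStarAlgAut_apply] at hs
  simp only [compose, Q]
  rw [hd, transpose_submatrix, submatrix_mul_equiv, submatrix_mul_equiv]
  simpa using! hs

theorem tendsto_compose {ι : Type*} {u : Filter ι} {Q : ι → Orth n} {l : ι → OrderedVec n}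
    {Q₀ : Orth n} {l₀ : OrderedVec n} (hQ : Tendsto (fun k => (Q k).1) u (𝓝 Q₀.1))
    (hl : Tendsto (fun k => (l k).1) u (𝓝 l₀.1)) :
    Tendsto (fun k => (compose (Q k) (l k).1).1) u (𝓝 (compose Q₀ l₀.1).1) := by
  have hd : Continuous fun v : EuclideanSpace ℝ (Fin n) => diagonal fun i => v i := by fun_prop
  exact (hQ.mul ((hd.tendsto l₀.1).comp hl)).mul
    ((continuous_id.matrix_transpose.tendsto Q₀.1).comp hQ)

theorem IsLocalMinSym.isLocalMinDecomp {p : ℕ} {F : SymMat n → ℝ}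
    {G : SymMat n → EuclideanSpace ℝ (Fin p)} {C : Set (EuclideanSpace ℝ (Fin n))}
    {X : SymMat n} (h : IsLocalMinSym F G C X) {P : Orth n × OrderedVec n}
    (hP : IsSpectralDecomposition X P) : IsLocalMinDecomp F G C P := by
  obtain ⟨δ, hδ, hmin⟩ := h
  by_contra hcon
  simp only [IsLocalMinDecomp] at hcon
  push Not at hcon
  choose R hR hQ hl hlt using fun k : ℕ => hcon (1 / ((k : ℝ) + 1)) (by positivity)
  have hlim := tendsto_one_div_add_atTop_nhds_zero_nat (𝕜 := ℝ)
  have hQ' : Tendsto (fun k => (R k).1.1) atTop (𝓝 P.1.1) :=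
    tendsto_iff_tendsto_frobDist.2 <|
      squeeze_zero (fun _ => by rw [frobDist_eq_sqrt]; positivity) hQ hlim
  have hl' : Tendsto (fun k => (R k).2.1) atTop (𝓝 P.2.1) :=
    tendsto_iff_norm_sub_tendsto_zero.2 <| squeeze_zero (fun _ => norm_nonneg _) hl hlim
  have hdist := tendsto_iff_tendsto_frobDist.1 (tendsto_compose hQ' hl')
  obtain ⟨k, hk⟩ := (hdist.eventually_le_const hδ).exists
  rw [IsSpectralDecomposition] at hP
  rw [← hP] at hk
  have := hmin (compose (R k).1 (R k).2.1)
    ⟨(hR k).1, by rw [eigenvalueVec_compose]; exact (hR k).2⟩ hk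
  exact absurd (hP ▸ hlt k) this.not_gt

/-- Two orthogonal matrices diagonalizing the same matrix with the same distinct eigenvalues
differ by a diagonal factor. -/
theorem isDiag_transpose_mul {Q Q' : Orth n} {l : EuclideanSpace ℝ (Fin n)}
    (hl : Function.Injective fun i => l i) (h : compose Q l = compose Q' l) :
    (Q.1ᵀ * Q'.1).IsDiag := by
  -- A matrix commuting with a diagonal matrix with distinct entries is diagonal: its `(i, j)` entry
  -- is annihilated by `l i - l j`.
  have hcomm : diagonal (fun i => l i) * (Q.1ᵀ * Q'.1) =
      (Q.1ᵀ * Q'.1) * diagonal fun i => l i := by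
    rw [← transpose_mul_compose_mul Q l]
    nth_rewrite 2 [transpose_mul_compose_mul Q l]
    rw [← transpose_mul_compose_mul Q' l, ← h]
    calc Q.1ᵀ * (compose Q l).1 * Q.1 * (Q.1ᵀ * Q'.1)
        = Q.1ᵀ * (compose Q l).1 * (Q.1 * Q.1ᵀ) * Q'.1 := by simp only [Matrix.mul_assoc]
      _ = Q.1ᵀ * (Q'.1 * Q'.1ᵀ) * (compose Q l).1 * Q'.1 := by
        simp [Q.mul_transpose_self, Q'.mul_transpose_self]
      _ = _ := by simp only [Matrix.mul_assoc]
  intro i j hij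
  have hij' := congrFun (congrFun hcomm i) j
  rw [diagonal_mul, mul_diagonal] at hij'
  have : (l i - l j) * (Q.1ᵀ * Q'.1) i j = 0 := by linarith
  exact (mul_eq_zero.1 this).resolve_left (sub_ne_zero.2 fun e => hij (hl e))

/-- Diagonal matrices commute, so `D` cancels against its transpose. No condition on `l` is needed,
so one fixed `D` serves a whole sequence of decompositions. -/
theorem compose_mul_inv_of_isDiag (Q D : Orth n) (hD : D.1.IsDiag)
    (l : EuclideanSpace ℝ (Fin n)) : compose (Q * D⁻¹) l = compose Q l := by
  have hcomm : D.1 * diagonal (fun i => l i) = diagonal (fun i => l i) * D.1 := by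
    rw [← (isDiag_iff_diagonal_diag D.1).1 hD]
    exact commute_diagonal _ _
  have hinv : (D⁻¹).1 = D.1ᵀ := rfl
  refine Subtype.ext ?_
  simp only [compose, Submonoid.coe_mul, hinv, transpose_mul, transpose_transpose]
  calc Q.1 * D.1ᵀ * diagonal (fun i => l i) * (D.1 * Q.1ᵀ)
      = Q.1 * (D.1ᵀ * (diagonal (fun i => l i) * D.1)) * Q.1ᵀ := by
        simp only [Matrix.mul_assoc]
    _ = Q.1 * diagonal (fun i => l i) * Q.1ᵀ := by
        rw [← hcomm, ← Matrix.mul_assoc D.1ᵀ, D.transpose_mul_self, Matrix.one_mul]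

/-- If the matrices `Q k Diag(l k) (Q k)ᵀ` converge to `X` and the `Q k` converge, then so do the
vectors `l k`, and the limits form a spectral decomposition of `X`. -/
theorem exists_tendsto_isSpectralDecomposition {ι : Type*} {u : Filter ι} [u.NeBot] {X : SymMat n}
    {Q : ι → Orth n} {l : ι → OrderedVec n} {Q₀ : Orth n}
    (hX : Tendsto (fun k => (compose (Q k) (l k).1).1) u (𝓝 X.1))
    (hQ : Tendsto (fun k => (Q k).1) u (𝓝 Q₀.1)) :
    ∃ l₀ : OrderedVec n, Tendsto (fun k => (l k).1) u (𝓝 l₀.1) ∧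
      IsSpectralDecomposition X (Q₀, l₀) := by
  -- Conjugating back by `Q k` recovers `Diag(l k)`, so its convergence needs no separate continuity
  -- of eigenvalues.
  have hdiag : Tendsto (fun k => diagonal fun i => (l k).1 i) u (𝓝 (Q₀.1ᵀ * X.1 * Q₀.1)) := by
    refine Tendsto.congr (fun k => transpose_mul_compose_mul (Q k) (l k).1) ?_
    exact (((continuous_id.matrix_transpose.tendsto Q₀.1).comp hQ).mul hX).mul hQ
  have hentry : ∀ i j, Tendsto (fun k => diagonal (fun i => (l k).1 i) i j) u
      (𝓝 ((Q₀.1ᵀ * X.1 * Q₀.1) i j)) := fun i j =>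
    tendsto_pi_nhds.1 (tendsto_pi_nhds.1 hdiag i) j
  have hcoord : ∀ i, Tendsto (fun k => (l k).1 i) u (𝓝 ((Q₀.1ᵀ * X.1 * Q₀.1) i i)) := by
    intro i
    simpa using hentry i i
  have hlim : Tendsto (fun k => (l k).1) u
      (𝓝 (WithLp.toLp 2 fun i => (Q₀.1ᵀ * X.1 * Q₀.1) i i)) :=
    ((PiLp.continuous_toLp 2 _).tendsto _).comp (tendsto_pi_nhds.2 hcoord)
  let l₀ : OrderedVec n := ⟨WithLp.toLp 2 fun i => (Q₀.1ᵀ * X.1 * Q₀.1) i i, fun i j hij =>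
    le_of_tendsto_of_tendsto' (hcoord j) (hcoord i) fun k => (l k).2 hij⟩
  exact ⟨l₀, hlim, Subtype.ext (tendsto_nhds_unique hX (tendsto_compose (l₀ := l₀) hQ hlim))⟩

theorem IsSpectralDecomposition.eigenvalueVec_eq {X : SymMat n} {P : Orth n × OrderedVec n}
    (hP : IsSpectralDecomposition X P) : eigenvalueVec X = P.2.1 := by
  rw [IsSpectralDecomposition] at hP
  rw [hP, eigenvalueVec_compose]

theorem IsLocalMinDecomp.isLocalMinSym {p : ℕ} {F : SymMat n → ℝ}
    {G : SymMat n → EuclideanSpace ℝ (Fin p)} {C : Set (EuclideanSpace ℝ (Fin n))}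
    {X : SymMat n} (hX : HasDistinctEigenvalues X) {P : Orth n × OrderedVec n}
    (hP : IsSpectralDecomposition X P) (h : IsLocalMinDecomp F G C P) :
    IsLocalMinSym F G C X := by
  obtain ⟨δ, hδ, hmin⟩ := h
  by_contra hcon
  simp only [IsLocalMinSym] at hcon
  push Not at hcon
  choose Y hY hdist hlt using fun k : ℕ => hcon (1 / ((k : ℝ) + 1)) (by positivity)
  have hYX : Tendsto (fun k => (Y k).1) atTop (𝓝 X.1) :=
    tendsto_iff_tendsto_frobDist.2 <|
      squeeze_zero (fun _ => by rw [frobDist_eq_sqrt]; positivity) hdist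
        tendsto_one_div_add_atTop_nhds_zero_nat
  choose R hR using fun k => exists_isSpectralDecomposition (Y k)
  have : FirstCountableTopology (Matrix (Fin n) (Fin n) ℝ) :=
    inferInstanceAs (FirstCountableTopology (Fin n → Fin n → ℝ))
  obtain ⟨U, hU, φ, hφ, hQ⟩ :=
    isCompact_orthogonalGroup.tendsto_subseq fun k => (R k).1.2
  have hYφ : Tendsto (fun k => (compose (R (φ k)).1 (R (φ k)).2.1).1) atTop (𝓝 X.1) := by
    refine (hYX.comp hφ.tendsto_atTop).congr fun k => ?_
    exact congrArg Subtype.val (hR (φ k))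
  obtain ⟨l₀, hl, hdec⟩ :=
    exists_tendsto_isSpectralDecomposition (Q₀ := ⟨U, hU⟩) hYφ hQ
  have hl₀ : l₀.1 = P.2.1 := hdec.eigenvalueVec_eq.symm.trans hP.eigenvalueVec_eq
  have hinj : Function.Injective fun i => P.2.1 i := by
    rw [← hP.eigenvalueVec_eq]
    exact hX
  -- The discrepancy between the limit `U` and the factor of `P`: `U = P.1 * D`, whence `U * D⁻¹ =
  -- P.1`.
  let D : Orth n := P.1⁻¹ * ⟨U, hU⟩
  have hD : D.1.IsDiag := by
    refine isDiag_transpose_mul (Q := P.1) (Q' := ⟨U, hU⟩) hinj ?_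
    exact hP.symm.trans (hdec.trans (by rw [hl₀]))
  have hQD : Tendsto (fun k => ((R (φ k)).1 * D⁻¹).1) atTop (𝓝 P.1.1) := by
    have hlim : U * (D⁻¹).1 = P.1.1 := by
      have : (⟨U, hU⟩ : Orth n) * D⁻¹ = P.1 := by simp [D]
      exact congrArg Subtype.val this
    rw [← hlim]
    exact hQ.mul tendsto_const_nhds
  rw [hl₀] at hl
  obtain ⟨k, hk₁, hk₂⟩ := (((tendsto_iff_tendsto_frobDist.1 hQD).eventually_le_const hδ).and
    ((tendsto_iff_norm_sub_tendsto_zero.1 hl).eventually_le_const hδ)).exists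
  have hcomp : compose ((R (φ k)).1 * D⁻¹) (R (φ k)).2.1 = Y (φ k) :=
    (compose_mul_inv_of_isDiag _ _ hD _).trans (hR (φ k)).symm
  have hle := hmin ((R (φ k)).1 * D⁻¹, (R (φ k)).2)
    ⟨by rw [hcomp]; exact (hY (φ k)).1, by
      rw [← (hR (φ k)).eigenvalueVec_eq]; exact (hY (φ k)).2⟩ hk₁ hk₂
  rw [hcomp, ← show X = compose P.1 P.2.1 from hP] at hle
  exact hle.not_gt (hlt (φ k))

theorem IsSpectralDecomposition.mem_feasible_iff {p : ℕ}
    {G : SymMat n → EuclideanSpace ℝ (Fin p)} {C : Set (EuclideanSpace ℝ (Fin n))}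
    {X : SymMat n} {P : Orth n × OrderedVec n} (hP : IsSpectralDecomposition X P) :
    X ∈ feasibleSym G C ↔ P ∈ feasibleDecomp G C := by
  rw [feasibleSym, feasibleDecomp, Set.mem_ofPred_eq, Set.mem_ofPred_eq, hP.eigenvalueVec_eq,
    ← show X = compose P.1 P.2.1 from hP]

end SpecOpt

theorem mainTheorem1 {n p : ℕ} (F : SpecOpt.SymMat n → ℝ)
    (G : SpecOpt.SymMat n → EuclideanSpace ℝ (Fin p))
    (C : Set (EuclideanSpace ℝ (Fin n)))
    (X : SpecOpt.SymMat n) (hX : SpecOpt.HasDistinctEigenvalues X) :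
    (SpecOpt.IsLocalMinSym F G C X ↔
      ∃ P, SpecOpt.IsSpectralDecomposition X P ∧ SpecOpt.IsLocalMinDecomp F G C P) ∧
    ((∃ P, SpecOpt.IsSpectralDecomposition X P ∧ SpecOpt.IsLocalMinDecomp F G C P) →
      ∀ P, SpecOpt.IsSpectralDecomposition X P → SpecOpt.IsLocalMinDecomp F G C P) ∧
    (∀ P, SpecOpt.IsSpectralDecomposition X P →
      (X ∈ SpecOpt.feasibleSym G C ↔ P ∈ SpecOpt.feasibleDecomp G C)) := by
  refine ⟨⟨fun h => ?_, fun ⟨P, hP, h⟩ => h.isLocalMinSym hX hP⟩,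
    fun ⟨P, hP, h⟩ R hR => (h.isLocalMinSym hX hP).isLocalMinDecomp hR,
    fun P hP => hP.mem_feasible_iff⟩
  obtain ⟨P, hP⟩ := SpecOpt.exists_isSpectralDecomposition X
  exact ⟨P, hP, h.isLocalMinDecomp hP⟩
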